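/- Let $k\ge 2$. A $k$-partite (unnormalized pure) state is a vector $\psi\in\mathcal H_1\otimes\cdots\otimes\mathcal H_k$, where the $\mathcal H_i$ are finite-dimensional complex vector spaces. For $k$-partite states $\psi\in\mathcal H_1\otimes\cdots\otimes\mathcal H_k$ and $\varphi\in\mathcal K_1\otimes\cdots\otimes\mathcal K_k$ write $\psi\to\varphi$ (SLOCC convertibility) if there are linear maps $A_i:\mathcal H_i\to\mathcal K_i$ with $\varphi=(A_1\otimes\cdots\otimes A_k)\psi$. The tensor power $\psi^{\otimes m}$ is regarded as a $k$-partite state in $\mathcal H_1^{\otimes m}\otimes\cdots\otimes\mathcal H_k^{\otimes m}$. For $n\ge 1$ put $$\omega_n(\psi,\varphi)=\frac1n\inf\{m\in\mathbb N \mid \psi^{\otimes m}\to\varphi^{\otimes n}\}\in[0,\infty],\qquad \inf\emptyset=\infty,$$ and let $\omega(\psi,\varphi)=\lim_{n\to\infty}\omega_n(\psi,\varphi)$ be the asymptotic SLOCC conversion rate. In $(\mathbb C^2)^{\otimes k}$, with $|0\rangle,|1\rangle$ the standard basis of $\mathbb C^2$, consider $$W=|10\ldots0\rangle+|010\ldots0\rangle+\cdots+|0\ldots01\rangle,\qquad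 GHZ=|00\ldots0\rangle+|11\ldots1\rangle .$$ **Theorem.** For every $k\ge2$ the limit $\omega(W,GHZ)$ exists and $$\omega(W,GHZ)=\frac{1}{h(1/k)},$$ where $h(p)=-p\log_2p-(1-p)\log_2(1-p)$ is the binary entropy function. -/

import Mathlib

open scoped TensorProduct ENNReal Topology

noncomputable section

/-- An (unnormalized) `k`-partite pure state: finite-dimensional complex vector spaces
`H 0, …, H (k-1)` together with a vector of their tensor product. Only the vector space structure
matters for SLOCC transformations, so no inner product is recorded. -/
structure PartiteState (k : ℕ) where
  /-- The local state spaces. -/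
  H : Fin k → Type
  [addCommGroup : ∀ i, AddCommGroup (H i)]
  [module : ∀ i, Module ℂ (H i)]
  [finite : ∀ i, FiniteDimensional ℂ (H i)]
  /-- The state vector. -/
  vec : PiTensorProduct ℂ H

namespace PartiteState

attribute [instance] PartiteState.addCommGroup PartiteState.module PartiteState.finite

variable {k : ℕ}

/-- `ψ.SLOCC φ`: there are linear maps `A i : H i → K i` with `φ = (A 0 ⊗ ⋯ ⊗ A (k-1)) ψ`. -/
def SLOCC (ψ φ : PartiteState k) : Prop :=
  ∃ A : ∀ i, ψ.H i →ₗ[ℂ] φ.H i, PiTensorProduct.map A ψ.vec = φ.vec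

/-- The trivial `k`-partite state `1 ⊗ ⋯ ⊗ 1` in `ℂ ⊗ ⋯ ⊗ ℂ`. -/
def unit (k : ℕ) : PartiteState k where
  H := fun _ => ℂ
  vec := PiTensorProduct.tprod ℂ (fun _ => (1 : ℂ))

/-- The tensor product of two `k`-partite states, again seen as a `k`-partite state: the `i`-th
party holds `H i ⊗ K i`, and `(⨂ᵢ xᵢ) ⊗ (⨂ᵢ yᵢ)` is regrouped as `⨂ᵢ (xᵢ ⊗ yᵢ)`. -/
def tensor (ψ φ : PartiteState k) : PartiteState k where
  H := fun i => ψ.H i ⊗[ℂ] φ.H i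
  vec := PiTensorProduct.map₂ (fun i => TensorProduct.mk ℂ (ψ.H i) (φ.H i)) ψ.vec φ.vec

/-- `n` copies of a `k`-partite state, as a `k`-partite state. -/
def tensorPow (ψ : PartiteState k) : ℕ → PartiteState k
  | 0 => unit k
  | n + 1 => (tensorPow ψ n).tensor ψ

/-- `ω_n(ψ, φ) = (1/n) inf {m ∈ ℕ | ψ^{⊗m} can be transformed by SLOCC into φ^{⊗n}}`, the infimum
of the empty set being `∞`. -/
def rate (n : ℕ) (ψ φ : PartiteState k) : ℝ≥0∞ :=
  (⨅ m ∈ {m : ℕ | (ψ.tensorPow m).SLOCC (φ.tensorPow n)}, (m : ℝ≥0∞)) / (n : ℝ≥0∞)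

/-- The limit `ω(ψ, φ) = lim_{n → ∞} ω_n(ψ, φ)` exists and equals `r`. -/
def HasAsymptoticRate (ψ φ : PartiteState k) (r : ℝ≥0∞) : Prop :=
  Filter.Tendsto (fun n : ℕ => rate n ψ φ) Filter.atTop (𝓝 r)

/-- The vector `|i⟩` of the computational basis of `ℂ^a`. -/
def ket {a : ℕ} (i : Fin a) : Fin a → ℂ := Pi.single i 1

/-- The `k`-partite W state `|10…0⟩ + |010…0⟩ + ⋯ + |0…01⟩`. -/
def W (k : ℕ) : PartiteState k where
  H := fun _ => Fin 2 → ℂ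
  vec := ∑ i : Fin k,
    PiTensorProduct.tprod ℂ (fun j : Fin k => ket (if j = i then (1 : Fin 2) else 0))

/-- The `k`-partite GHZ state `|00…0⟩ + |11…1⟩`. -/
def GHZ (k : ℕ) : PartiteState k where
  H := fun _ => Fin 2 → ℂ
  vec := ∑ i : Fin 2, PiTensorProduct.tprod ℂ (fun _ : Fin k => ket i)

end PartiteState

/-- The binary entropy function, with logarithms to base `2`. -/
def binaryEntropy (p : ℝ) : ℝ :=
  -p * Real.logb 2 p - (1 - p) * Real.logb 2 (1 - p)

end

/-! Write k = n + 1. Expanded, W^{⊗m} is a sum over labellings f : [m] → [k] of product basis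
vectors whose i-th factor is the indicator word of the fiber f⁻¹(i), while GHZ^{⊗l} is a diagonal
tensor of size 2^l. Both bounds are statements about this support.

Lower bound on the rate: some fiber of f has at most m/k elements, so W^{⊗m} is covered by k·2^{m
h(1/k)} slices (`card_low_weight_le`). Slice rank does not grow under local maps, and that of a
diagonal tensor is its size (Tao), so 2^l ≤ k·2^{m h(1/k)}.

Upper bound: a set Φ of labellings that is a free diagonal of the support yields a GHZ state of size
|Φ| (`HasForm.slocc_of_free`). It is found by linear hashing, as in Strassen and
Coppersmith–Winograd (`exists_free_balanced`). For m = qk, the fibers of balanced labellings are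
hashed into a group G; the labellings kept are those whose hashes form a vector of a sum-free family
of size |G|^{1-o(1)} and which meet no rival sharing a fiber. Rivals are rare once |G| is a constant
times c^q, where c^{n-1} = n^n. About (n+1)^{q(n+1)} / |G|^{n-1} labellings survive, which is 2^{m
h(1/k)} up to subexponential factors. -/

namespace PartiteState

variable {k : ℕ}

/-! ### States as sums over a labelled support -/

/-- `ψ.HasForm g` says that, in suitable bases of the local spaces labelled by `X`, the state `ψ`
is `∑ a, ⨂ i, |g a i⟩`. -/
def HasForm {A X : Type} [Fintype A] (ψ : PartiteState k) (g : A → Fin k → X) : Prop :=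
  ∃ e : ∀ i, Module.Basis X ℂ (ψ.H i),
    ψ.vec = ∑ a, PiTensorProduct.tprod ℂ (fun i => e i (g a i))

theorem HasForm.tensor {A X A' X' : Type} [Fintype A] [Fintype A'] {ψ φ : PartiteState k}
    {g : A → Fin k → X} {g' : A' → Fin k → X'} (hψ : ψ.HasForm g) (hφ : φ.HasForm g') :
    (ψ.tensor φ).HasForm (fun (a : A × A') i => (g a.1 i, g' a.2 i)) := by
  obtain ⟨e, he⟩ := hψ
  obtain ⟨e', he'⟩ := hφ
  refine ⟨fun i => (e i).tensorProduct (e' i), ?_⟩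
  change PiTensorProduct.map₂ _ ψ.vec φ.vec = _
  rw [he, he', Fintype.sum_prod_type]
  simp only [map_sum, LinearMap.sum_apply, PiTensorProduct.map₂_tprod_tprod]
  rw [Finset.sum_comm]
  refine Finset.sum_congr rfl fun a _ => Finset.sum_congr rfl fun b _ => ?_
  congr 1
  ext i
  exact (Module.Basis.tensorProduct_apply (e i) (e' i) _ _).symm

theorem HasForm.reindex {A X A' X' : Type} [Fintype A] [Fintype A'] {ψ : PartiteState k}
    {g : A → Fin k → X} {g' : A' → Fin k → X'} (hψ : ψ.HasForm g) (eA : A ≃ A') (eX : X ≃ X')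
    (h : ∀ a i, g' (eA a) i = eX (g a i)) : ψ.HasForm g' := by
  obtain ⟨e, he⟩ := hψ
  refine ⟨fun i => (e i).reindex eX, ?_⟩
  rw [he, ← eA.sum_comp]
  simp [h]

theorem hasForm_unit : (unit k).HasForm (fun (_ : Unit) _ => ()) := by
  refine ⟨fun _ => Module.Basis.singleton Unit ℂ, ?_⟩
  change PiTensorProduct.tprod ℂ (s := fun _ : Fin k => ℂ) (fun _ => 1) = ∑ _ : Unit,
    PiTensorProduct.tprod ℂ (s := fun _ : Fin k => ℂ) fun _ => Module.Basis.singleton Unit ℂ ()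
  simp

theorem HasForm.tensorPow {A X : Type} [Fintype A] {ψ : PartiteState k} {g : A → Fin k → X}
    (hψ : ψ.HasForm g) (m : ℕ) :
    (ψ.tensorPow m).HasForm (fun (f : Fin m → A) i j => g (f j) i) := by
  induction m with
  | zero =>
    exact hasForm_unit.reindex (Equiv.ofUnique _ _) (Equiv.ofUnique _ _)
      fun a i => Subsingleton.elim _ _
  | succ m ih =>
    refine (ih.tensor hψ).reindex ((Equiv.prodComm _ _).trans (Fin.snocEquiv fun _ => A))
      ((Equiv.prodComm _ _).trans (Fin.snocEquiv fun _ => X)) fun a i => ?_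
    ext j
    refine Fin.lastCases ?_ (fun j => ?_) j <;> simp

theorem hasForm_W (k : ℕ) :
    (W k).HasForm (fun (a i : Fin k) => if i = a then (1 : Fin 2) else 0) := by
  refine ⟨fun _ => Pi.basisFun ℂ (Fin 2), ?_⟩
  change _ = ∑ a, PiTensorProduct.tprod ℂ (s := fun _ : Fin k => Fin 2 → ℂ) fun i =>
    Pi.basisFun ℂ (Fin 2) (if i = a then 1 else 0)
  simp only [Pi.basisFun_apply]
  rfl

theorem hasForm_GHZ (k : ℕ) : (GHZ k).HasForm (fun (a : Fin 2) (_ : Fin k) => a) := by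
  refine ⟨fun _ => Pi.basisFun ℂ (Fin 2), ?_⟩
  change _ = ∑ a, PiTensorProduct.tprod ℂ (s := fun _ : Fin k => Fin 2 → ℂ) fun _ =>
    Pi.basisFun ℂ (Fin 2) a
  simp only [Pi.basisFun_apply]
  rfl

/-- A free diagonal inside the support of a state yields a SLOCC transformation to a GHZ state. -/
theorem HasForm.slocc_of_free {A X Y : Type} [Fintype A] [Fintype Y]
    {ψ φ : PartiteState k} {g : A → Fin k → X} (hψ : ψ.HasForm g)
    (hφ : φ.HasForm (fun (y : Y) (_ : Fin k) => y)) (c : Y → A) (hc : Function.Injective c)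
    (hinj : ∀ i, Function.Injective fun y => g (c y) i)
    (hfree : ∀ a, (∀ i, ∃ y, g a i = g (c y) i) → ∃ y, a = c y) : ψ.SLOCC φ := by
  classical
  obtain ⟨e, he⟩ := hψ
  obtain ⟨e', he'⟩ := hφ
  -- Labels used by the diagonal go to the matching basis vector, all others to 0. A surviving term
  -- uses only diagonal labels, hence lies on the diagonal by freeness.
  let T : ∀ i, X → φ.H i := fun i x => if h : ∃ y, x = g (c y) i then e' i h.choose else 0
  have hT : ∀ i y, T i (g (c y) i) = e' i y := by
    intro i y
    have h : ∃ y', g (c y) i = g (c y') i := ⟨y, rfl⟩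
    simp only [T, dif_pos h]
    rw [← hinj i h.choose_spec]
  refine ⟨fun i => (e i).constr ℂ (T i), ?_⟩
  rw [he, he', map_sum]
  simp only [PiTensorProduct.map_tprod, Module.Basis.constr_basis]
  have hz : ∀ a ∉ Finset.univ.image c,
      PiTensorProduct.tprod ℂ (fun i => T i (g a i)) = 0 := by
    intro a ha
    have : ∃ i, ∀ y, g a i ≠ g (c y) i := by
      by_contra! hcon
      obtain ⟨y, hy⟩ := hfree a hcon
      exact ha (by simp [hy])
    obtain ⟨i, hi⟩ := this
    exact MultilinearMap.map_coord_zero _ i (dif_neg (by simpa using hi))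
  rw [← Finset.sum_subset (Finset.subset_univ (Finset.univ.image c)) fun a _ ha => hz a ha,
    Finset.sum_image hc.injOn]
  simp [hT]

end PartiteState

/-! ### Slice rank of diagonal tensors -/

/-- A finite-dimensional space of functions contains one whose support is at least as large as
the dimension of the space. -/
theorem Submodule.exists_finrank_le_card_support {Y : Type*} [Fintype Y] [DecidableEq Y]
    (V : Submodule ℂ (Y → ℂ)) :
    ∃ v ∈ V, Module.finrank ℂ V ≤ (Finset.univ.filter fun y => v y ≠ 0).card := by
  classical
  let S : Finset Y := Finset.univ.filter fun y => ∃ v ∈ V, v y ≠ 0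
  let p : S → Submodule ℂ V := fun y => LinearMap.ker ((LinearMap.proj (y : Y)).comp V.subtype)
  have hp : ∀ y, p y ≠ ⊤ := by
    rintro ⟨y, hy⟩ h
    obtain ⟨v, hv, hvy⟩ := (Finset.mem_filter.1 hy).2
    have : (⟨v, hv⟩ : V) ∈ p ⟨y, hy⟩ := h ▸ Submodule.mem_top
    exact hvy this
  -- Over the infinite field ℂ, finitely many proper subspaces do not cover `V`, so one vector is
  -- nonzero on all of `S`; restriction to `S` is injective on `V`.
  have hne := Submodule.iUnion_ssubset_of_forall_ne_top_of_card_lt (Finset.univ) p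
    (fun y => hp y) (by simp)
  obtain ⟨v, -, hv⟩ := Set.exists_of_ssubset hne
  simp only [Finset.mem_univ, Set.iUnion_true, Set.mem_iUnion, not_exists] at hv
  refine ⟨v, v.2, ?_⟩
  have hS : S ⊆ Finset.univ.filter fun y => (v : Y → ℂ) y ≠ 0 := by
    intro y hy
    have := hv ⟨y, hy⟩
    simpa [p] using this
  refine le_trans ?_ (Finset.card_le_card hS)
  let r : V →ₗ[ℂ] (S → ℂ) := (LinearMap.funLeft ℂ ℂ (Subtype.val : S → Y)).comp V.subtype
  have hr : Function.Injective r := by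
    rw [← LinearMap.ker_eq_bot, LinearMap.ker_eq_bot']
    intro w hw
    ext y
    by_contra hwy
    have hy : y ∈ S := Finset.mem_filter.2 ⟨Finset.mem_univ _, w, w.2, hwy⟩
    exact hwy (congrFun hw ⟨y, hy⟩)
  simpa using LinearMap.finrank_le_finrank_of_injective hr

/-- The diagonal form with weights `D` has a kernel of dimension the number of zeros of `D`; up to
that kernel, `U` embeds in the annihilator of `V`. -/
theorem Submodule.finrank_add_finrank_le_of_weighted_orthogonal {Y : Type*} [Fintype Y]
    [DecidableEq Y] (D : Y → ℂ) (U V : Submodule ℂ (Y → ℂ))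
    (h : ∀ u ∈ U, ∀ v ∈ V, ∑ y, D y * u y * v y = 0) :
    Module.finrank ℂ U + Module.finrank ℂ V ≤
      Fintype.card Y + (Finset.univ.filter fun y => D y = 0).card := by
  classical
  let Z : Finset Y := Finset.univ.filter fun y => D y = 0
  let T : (Y → ℂ) →ₗ[ℂ] Module.Dual ℂ (Y → ℂ) :=
    (dotProductEquiv ℂ Y).toLinearMap.comp (LinearMap.mulLeft ℂ D)
  have hT : ∀ u v, T u v = ∑ y, D y * u y * v y := fun u v => by
    simp [T, dotProduct]
  let T' : U →ₗ[ℂ] V.dualAnnihilator := (T.domRestrict U).codRestrict _ fun u => by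
    rw [Submodule.mem_dualAnnihilator]
    intro v hv
    rw [LinearMap.domRestrict_apply, hT]
    exact h u u.2 v hv
  let r : U →ₗ[ℂ] (Z → ℂ) := (LinearMap.funLeft ℂ ℂ (Subtype.val : Z → Y)).comp U.subtype
  have hinj : Function.Injective (T'.prod r) := by
    rw [← LinearMap.ker_eq_bot, LinearMap.ker_eq_bot']
    intro u hu
    have h1 : T u = 0 := congrArg (fun p => (p.1 : Module.Dual ℂ (Y → ℂ))) hu
    have h2 : r u = 0 := congrArg Prod.snd hu
    have h3 : D * (u : Y → ℂ) = 0 := (dotProductEquiv ℂ Y).map_eq_zero_iff.1 h1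
    ext y
    by_cases hy : D y = 0
    · exact congrFun h2 ⟨y, Finset.mem_filter.2 ⟨Finset.mem_univ _, hy⟩⟩
    · simpa [hy] using congrFun h3 y
  have h1 := LinearMap.finrank_le_finrank_of_injective hinj
  have h2 := Subspace.finrank_add_finrank_dualAnnihilator_eq V
  rw [Module.finrank_prod, Module.finrank_fintype_fun_eq_card, Fintype.card_coe] at h1
  rw [Module.finrank_fintype_fun_eq_card] at h2
  change _ ≤ _ + Z.card
  omega

/-- Dual form of Tao's slice rank bound. Fixing vectors of large support in all but two of the
spaces leaves a diagonal bilinear form whose weight vanishes at few points. -/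
theorem Submodule.card_le_sum_codim_of_sum_prod_eq_zero {Y : Type*} [Fintype Y] {n : ℕ}
    (V : Fin (n + 2) → Submodule ℂ (Y → ℂ))
    (h : ∀ l : Fin (n + 2) → Y → ℂ, (∀ i, l i ∈ V i) → ∑ y, ∏ i, l i y = 0) :
    Fintype.card Y ≤ ∑ i, (Fintype.card Y - Module.finrank ℂ (V i)) := by
  classical
  choose l hl hcard using fun i : Fin n => (V i.succ.succ).exists_finrank_le_card_support
  have key := Submodule.finrank_add_finrank_le_of_weighted_orthogonal (fun y => ∏ i, l i y)
    (V 0) (V 1) fun u hu v hv => by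
      have := h (Fin.cons u (Fin.cons v l)) (by
        refine Fin.cases hu (Fin.cases hv hl))
      rw [← this]
      refine Finset.sum_congr rfl fun y _ => ?_
      rw [Fin.prod_univ_succ, Fin.prod_univ_succ]
      simp only [Fin.cons_zero, Fin.cons_succ]
      ring
  have hz : (Finset.univ.filter fun y => ∏ i, l i y = 0).card ≤
      ∑ i : Fin n, (Fintype.card Y - Module.finrank ℂ (V i.succ.succ)) := by
    calc _ ≤ (Finset.univ.biUnion fun i : Fin n => Finset.univ.filter fun y => l i y = 0).card :=
          Finset.card_le_card fun y hy => by
            simpa [Finset.prod_eq_zero_iff] using hy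
      _ ≤ ∑ i : Fin n, (Finset.univ.filter fun y => l i y = 0).card := Finset.card_biUnion_le
      _ ≤ _ := Finset.sum_le_sum fun i _ => by
          have h1 := Finset.card_filter_add_card_filter_not (s := (Finset.univ : Finset Y))
            (fun y => l i y = 0)
          have h2 := hcard i
          rw [Finset.card_univ] at h1
          simp only [ne_eq] at h2
          omega
  have h0 : ∀ i, Module.finrank ℂ (V i) ≤ Fintype.card Y := fun i => by
    simpa using Submodule.finrank_le (V i)
  have h00 := h0 0
  have h01 := h0 1
  rw [Fin.sum_univ_succ, Fin.sum_univ_succ, Fin.succ_zero_eq_one]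
  omega

namespace PartiteState

/-- The slice rank bound: if a state is covered by few slices, so is every GHZ state that it can
be transformed into. -/
theorem HasForm.card_le_of_slocc {n : ℕ} {A X Y : Type} [Fintype A] [Fintype Y]
    {ψ φ : PartiteState (n + 2)} {g : A → Fin (n + 2) → X} (hψ : ψ.HasForm g)
    (hφ : φ.HasForm (fun (y : Y) (_ : Fin (n + 2)) => y)) (Z : Fin (n + 2) → Finset X)
    (hZ : ∀ a, ∃ i, g a i ∈ Z i) (h : ψ.SLOCC φ) :
    Fintype.card Y ≤ ∑ i, (Z i).card := by
  classical
  obtain ⟨e, he⟩ := hψ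
  obtain ⟨e', he'⟩ := hφ
  obtain ⟨T, hT⟩ := h
  -- Functionals killing the images of the labels in `Z i`, at most `(Z i).card` conditions. A
  -- product of such functionals kills every term of the transformed state, since each term has a
  -- factor from some `Z i`.
  let V : Fin (n + 2) → Submodule ℂ (Y → ℂ) := fun i => LinearMap.ker
    (LinearMap.pi fun z : Z i =>
      dotProductEquiv ℂ Y (fun y => (e' i).repr (T i (e i z)) y))
  have hV : ∀ i, Fintype.card Y - Module.finrank ℂ (V i) ≤ (Z i).card := fun i => by
    have h1 := LinearMap.finrank_range_add_finrank_ker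
      (LinearMap.pi fun z : Z i =>
        dotProductEquiv ℂ Y (fun y => (e' i).repr (T i (e i z)) y))
    have h2 := Submodule.finrank_le (LinearMap.range (LinearMap.pi fun z : Z i =>
        dotProductEquiv ℂ Y (fun y => (e' i).repr (T i (e i z)) y)))
    rw [Module.finrank_fintype_fun_eq_card, Fintype.card_coe] at h2
    rw [Module.finrank_fintype_fun_eq_card] at h1
    change _ + Module.finrank ℂ (V i) = _ at h1
    omega
  refine (Submodule.card_le_sum_codim_of_sum_prod_eq_zero V fun l hl => ?_).trans
    (Finset.sum_le_sum fun i _ => hV i)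
  let L : ∀ i, φ.H i →ₗ[ℂ] ℂ := fun i => (e' i).constr ℂ (l i)
  let F := PiTensorProduct.lift ((MultilinearMap.mkPiAlgebra ℂ (Fin (n + 2)) ℂ).compLinearMap L)
  have hF : ∀ x, F (PiTensorProduct.tprod ℂ x) = ∏ i, L i (x i) := fun x => by simp [F]
  have hL : ∀ i, ∀ z ∈ Z i, L i (T i (e i z)) = 0 := by
    intro i z hz
    have := congrFun (LinearMap.mem_ker.1 (hl i)) ⟨z, hz⟩
    simp only [L, Module.Basis.constr_apply_fintype]
    simpa [dotProduct] using this
  have h1 : F φ.vec = ∑ y, ∏ i, l i y := by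
    rw [he', map_sum]
    simp only [hF, L, Module.Basis.constr_basis]
  rw [← h1, ← hT, he, map_sum, map_sum]
  refine Finset.sum_eq_zero fun a _ => ?_
  obtain ⟨i, hi⟩ := hZ a
  rw [PiTensorProduct.map_tprod, hF]
  exact Finset.prod_eq_zero (Finset.mem_univ i) (hL i _ hi)

end PartiteState

/-! ### Pairs of labellings and their collisions -/

/-- Two labellings have the same set of positions with label `i`, for some `i`. -/
def SharesFiber {J κ : Type} (f f' : J → κ) : Prop :=
  ∃ i, ∀ j, f j = i ↔ f' j = i

/-- The equivalence relation on labels generated by `f j ∼ f' j`. -/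
def fiberSetoid {J κ : Type} (f f' : J → κ) : Setoid κ :=
  Relation.EqvGen.setoid fun a b => ∃ j, a = f j ∧ b = f' j

/-- A choice of representatives for `fiberSetoid f f'`. -/
noncomputable def fiberRep {J κ : Type} (f f' : J → κ) (a : κ) : κ :=
  (Quotient.mk (fiberSetoid f f') a).out

theorem fiberRep_rel {J κ : Type} (f f' : J → κ) (a : κ) :
    Relation.EqvGen (fun a b => ∃ j, a = f j ∧ b = f' j) (fiberRep f f' a) a :=
  Quotient.mk_out (s := fiberSetoid f f') a

theorem fiberRep_fiberRep {J κ : Type} (f f' : J → κ) (a : κ) :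
    fiberRep f f' (fiberRep f f' a) = fiberRep f f' a := by
  simp [fiberRep]

theorem fiberRep_apply_eq {J κ : Type} (f f' : J → κ) (j : J) :
    fiberRep f f' (f' j) = fiberRep f f' (f j) :=
  congrArg Quotient.out (Quotient.sound (s := fiberSetoid f f')
    ((Relation.EqvGen.rel _ _ ⟨j, rfl, rfl⟩).symm))

/-- A label with a common fiber is isolated in the graph with edges `f j — f' j`. -/
theorem eq_of_fiberRep_eq {J κ : Type} {f f' : J → κ} {i : κ} (h : ∀ j, f j = i ↔ f' j = i)
    {a : κ} (ha : fiberRep f f' a = fiberRep f f' i) : a = i := by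
  have key : ∀ a b, Relation.EqvGen (fun a b => ∃ j, a = f j ∧ b = f' j) a b →
      (a = i ↔ b = i) := by
    intro a b hab
    induction hab with
    | rel a b hr => obtain ⟨j, rfl, rfl⟩ := hr; exact h j
    | refl a => rfl
    | symm a b _ ih => exact ih.symm
    | trans a b c _ _ ih1 ih2 => exact ih1.trans ih2
  have h1 := fiberRep_rel f f' a
  rw [ha] at h1
  exact (key _ _ h1).1 ((key _ _ (fiberRep_rel f f' i)).2 rfl)

/-- The number of weights for which two labellings have the same fiber sums. -/
theorem card_fiberSum_eq_mul_le {J κ G : Type} [Fintype J] [Fintype κ] [DecidableEq κ]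
    [AddCommGroup G] [Fintype G] (f f' : J → κ) :
    Nat.card {w : J → G // ∀ i, ∑ j with f' j = i, w j = ∑ j with f j = i, w j} *
      Fintype.card G ^ (Finset.univ.filter fun a => fiberRep f f' a ≠ a).card ≤
      Fintype.card G ^ Fintype.card J := by
  classical
  -- The weights counted form the kernel of this difference of fiber sums, so its range must be
  -- bounded below.
  let φ : (J → G) →+ (κ → G) :=
    ∑ j, ((AddMonoidHom.single (fun _ : κ => G) (f' j)).comp (Pi.evalAddMonoidHom _ j) -
      (AddMonoidHom.single (fun _ : κ => G) (f j)).comp (Pi.evalAddMonoidHom _ j))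
  have hφ : ∀ w i, φ w i = ∑ j with f' j = i, w j - ∑ j with f j = i, w j := by
    intro w i
    simp [φ, Finset.sum_apply, Finset.sum_filter, Pi.single_apply, eq_comm]
  have hrange : ∀ a b, Relation.EqvGen (fun a b => ∃ j, a = f j ∧ b = f' j) a b →
      ∀ g : G, (Pi.single b g - Pi.single a g : κ → G) ∈ φ.range := by
    intro a b hab g
    induction hab with
    | rel a b hr =>
      obtain ⟨j, rfl, rfl⟩ := hr
      refine ⟨Pi.single j g, ?_⟩
      simp only [φ, AddMonoidHom.finsetSum_apply, AddMonoidHom.sub_apply,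
        AddMonoidHom.comp_apply, Pi.evalAddMonoidHom_apply, AddMonoidHom.single_apply]
      rw [Finset.sum_eq_single j]
      · simp
      · intro j' _ hj'
        simp [hj']
      · simp
    | refl a => simp
    | symm a b _ ih => simpa using φ.range.neg_mem ih
    | trans a b c _ _ ih1 ih2 => simpa using φ.range.add_mem ih2 ih1
  let S := {a : κ // fiberRep f f' a ≠ a}
  -- Differences between a label and its class representative, one for each non-representative, are
  -- independent elements of the range.
  let ι : (S → G) → φ.range := fun v =>
    ⟨∑ a : S, (Pi.single (a : κ) (v a) - Pi.single (fiberRep f f' a) (v a)),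
      φ.range.sum_mem fun a _ => hrange _ _ (fiberRep_rel f f' a) _⟩
  have hι : Function.Injective ι := by
    intro v v' hv
    have hval : ∀ v : S → G, ∀ a : S, (ι v : κ → G) a = v a := by
      intro v a
      simp only [ι, Finset.sum_apply, Pi.sub_apply]
      rw [Finset.sum_eq_single a]
      · rw [Pi.single_eq_same, Pi.single_eq_of_ne a.2.symm, sub_zero]
      · intro b _ hb
        rw [Pi.single_eq_of_ne (fun h => hb (Subtype.ext h.symm)), Pi.single_eq_of_ne, sub_zero]
        intro h
        exact a.2 (by rw [h, fiberRep_fiberRep])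
      · simp
    ext a
    rw [← hval v a, hv, hval v' a]
  have h1 : Fintype.card G ^ (Finset.univ.filter fun a => fiberRep f f' a ≠ a).card ≤
      Nat.card φ.range := by
    have := Nat.card_le_card_of_injective ι hι
    rwa [Nat.card_eq_fintype_card, Fintype.card_fun, Fintype.card_subtype] at this
  have h2 : Nat.card φ.ker * Nat.card φ.range = Fintype.card G ^ Fintype.card J := by
    rw [← AddSubgroup.index_ker, AddSubgroup.card_mul_index, Nat.card_eq_fintype_card,
      Fintype.card_fun]
  rw [← h2]
  refine Nat.mul_le_mul (Nat.card_le_card_of_injective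
    (fun w => (⟨w.1, ?_⟩ : φ.ker)) fun w w' h => ?_) h1
  · ext i
    rw [hφ, w.2 i, sub_self]
    rfl
  · exact Subtype.ext (congrArg (fun x : φ.ker => (x : J → G)) h)

/-- A class of size s contributes s^s to the product and s − 1 non-representatives to the exponent.
-/
theorem Finset.prod_card_fiber_le {κ : Type} [Fintype κ] [DecidableEq κ] {n : ℕ} {c : ℝ}
    (hc : ∀ s : ℕ, 1 ≤ s → s ≤ n → (s : ℝ) ^ s ≤ c ^ (s - 1)) {ρ : κ → κ}
    (hρ : ∀ a, ρ (ρ a) = ρ a) (hn : ∀ b, (Finset.univ.filter fun a => ρ a = b).card ≤ n) :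
    ∏ a, ((Finset.univ.filter fun b => ρ b = ρ a).card : ℝ) ≤
      c ^ (Finset.univ.filter fun a => ρ a ≠ a).card := by
  classical
  let R := Finset.univ.filter fun a => ρ a = a
  have hR : ∀ a ∈ (Finset.univ : Finset κ), ρ a ∈ R := fun a _ => by simp [R, hρ]
  have hpos : ∀ r ∈ R, 1 ≤ (Finset.univ.filter fun a => ρ a = r).card := fun r hr =>
    Finset.card_pos.2 ⟨r, by simpa [R] using hr⟩
  have hcard : (Finset.univ.filter fun a => ρ a ≠ a).card =
      ∑ r ∈ R, ((Finset.univ.filter fun a => ρ a = r).card - 1) := by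
    have h1 := Finset.card_eq_sum_card_fiberwise hR
    have h2 := Finset.card_filter_add_card_filter_not (s := (Finset.univ : Finset κ))
      (fun a => ρ a = a)
    have h3 : ∑ r ∈ R, ((Finset.univ.filter fun a => ρ a = r).card - 1) + R.card =
        ∑ r ∈ R, (Finset.univ.filter fun a => ρ a = r).card := by
      rw [Finset.card_eq_sum_ones, ← Finset.sum_add_distrib]
      exact Finset.sum_congr rfl fun r hr => Nat.sub_add_cancel (hpos r hr)
    simp only [R, ne_eq] at *
    omega
  rw [← Finset.prod_fiberwise_of_maps_to hR, hcard, ← Finset.prod_pow_eq_pow_sum]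
  refine Finset.prod_le_prod (fun r _ => Finset.prod_nonneg fun _ _ => Nat.cast_nonneg _)
    fun r hr => ?_
  refine le_trans (le_of_eq ?_) (hc _ (hpos r hr) (hn r))
  rw [← Finset.prod_const]
  refine Finset.prod_congr rfl fun a ha => ?_
  rw [(Finset.mem_filter.1 ha).2]

open Classical in
/-- The labellings by `κ` in which every label occurs `q` times. -/
noncomputable def balanced (J κ : Type) [Fintype J] [Fintype κ] (q : ℕ) : Finset (J → κ) :=
  Finset.univ.filter fun f => ∀ i, (Finset.univ.filter fun j => f j = i).card = q

theorem mem_balanced {J κ : Type} [Fintype J] [Fintype κ] [DecidableEq κ] {q : ℕ} {f : J → κ} :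
    f ∈ balanced J κ q ↔ ∀ i, (Finset.univ.filter fun j => f j = i).card = q := by
  simp only [balanced, Finset.mem_filter_univ]
  refine forall_congr' fun i => ?_
  convert Iff.rfl

theorem card_comp_eq_comp {J κ : Type} [Fintype J] [Fintype κ] [DecidableEq J] [DecidableEq κ]
    {q : ℕ} {f : J → κ} (hf : f ∈ balanced J κ q) (ρ : κ → κ) :
    (Finset.univ.filter fun f' : J → κ => ∀ j, ρ (f' j) = ρ (f j)).card =
      (∏ a, (Finset.univ.filter fun b => ρ b = ρ a).card) ^ q := by
  have h1 : (Finset.univ.filter fun f' : J → κ => ∀ j, ρ (f' j) = ρ (f j)) =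
      Fintype.piFinset fun j => Finset.univ.filter fun b => ρ b = ρ (f j) := by
    ext f'
    simp
  rw [h1, Fintype.card_piFinset, ← Finset.prod_fiberwise Finset.univ f, ← Finset.prod_pow]
  refine Finset.prod_congr rfl fun a _ => ?_
  rw [← mem_balanced.1 hf a, ← Finset.prod_const]
  refine Finset.prod_congr rfl fun j hj => ?_
  rw [(Finset.mem_filter.1 hj).2]

open Classical in
-- Union bound over rivals of `f`, grouped by the map ρ = `fiberRep f f'`, of which there are at
-- most |κ|^|κ|. With r non-representatives, at most c^{rq} rivals agree with `f` modulo ρ, against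
-- M^r ≥ (C c^q)^r; and r ≥ 1.
theorem sum_inv_pow_card_le {J κ : Type} [Fintype J] [Fintype κ] {q n : ℕ} {c M C : ℝ}
    (hκ : Fintype.card κ = n + 1) (hn : 1 ≤ n)
    (hc : ∀ s : ℕ, 1 ≤ s → s ≤ n → (s : ℝ) ^ s ≤ c ^ (s - 1)) (hC : 1 ≤ C)
    (hcpos : 0 < c) (hM : C * c ^ q ≤ M) {f : J → κ} (hf : f ∈ balanced J κ q) :
    ∑ f' ∈ (balanced J κ q).filter (fun f' => f' ≠ f ∧ SharesFiber f f'),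
      (M ^ (Finset.univ.filter fun a => fiberRep f f' a ≠ a).card)⁻¹ ≤
      (Fintype.card κ : ℝ) ^ Fintype.card κ / C := by
  have hC0 : 0 < C := by linarith
  have hM0 : 0 < M := lt_of_lt_of_le (by positivity) hM
  rw [← Finset.sum_fiberwise _ (fun f' => fiberRep f f')]
  have hterm : ∀ ρ : κ → κ, ∑ f' ∈ ((balanced J κ q).filter
      (fun f' => f' ≠ f ∧ SharesFiber f f')).filter (fun f' => fiberRep f f' = ρ),
      (M ^ (Finset.univ.filter fun a => fiberRep f f' a ≠ a).card)⁻¹ ≤ C⁻¹ := by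
    intro ρ
    rcases Finset.eq_empty_or_nonempty (((balanced J κ q).filter
      (fun f' => f' ≠ f ∧ SharesFiber f f')).filter (fun f' => fiberRep f f' = ρ)) with h | h
    · rw [h, Finset.sum_empty]
      positivity
    obtain ⟨f₀, hf₀⟩ := h
    simp only [Finset.mem_filter] at hf₀
    obtain ⟨⟨-, hne, i, hi⟩, rfl⟩ := hf₀
    generalize hρdef : fiberRep f f₀ = ρ at *
    have hidem : ∀ a, ρ (ρ a) = ρ a := hρdef ▸ fiberRep_fiberRep f f₀
    -- The shared label is a class by itself, so no class contains all n + 1 ≥ 2 labels.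
    have hsize : ∀ b, (Finset.univ.filter fun a => ρ a = b).card ≤ n := by
      intro b
      by_contra! hcon
      have huniv : (Finset.univ.filter fun a => ρ a = b) = Finset.univ := by
        rw [← Finset.card_eq_iff_eq_univ]
        exact le_antisymm (Finset.card_le_univ _) (by omega)
      have hall : ∀ a, ρ a = b := fun a =>
        Finset.filter_eq_self.1 huniv a (Finset.mem_univ a)
      have : ∀ a, a = i := fun a =>
        eq_of_fiberRep_eq hi (by rw [hρdef, hall a, hall i])
      have := Fintype.card_le_one_iff.2 fun a b => (this a).trans (this b).symm
      omega
    have hr : 1 ≤ (Finset.univ.filter fun a => ρ a ≠ a).card := by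
      obtain ⟨j, hj⟩ := Function.ne_iff.1 hne
      have h1 : ρ (f₀ j) = ρ (f j) := hρdef ▸ fiberRep_apply_eq f f₀ j
      by_contra! hcon
      have h0 : ∀ a, ρ a = a := by
        simpa [Finset.filter_eq_empty_iff] using hcon
      exact hj (by rw [← h0 (f₀ j), h1, h0])
    set r := (Finset.univ.filter fun a => ρ a ≠ a).card with hrdef
    calc _ = ∑ f' ∈ ((balanced J κ q).filter
          (fun f' => f' ≠ f ∧ SharesFiber f f')).filter (fun f' => fiberRep f f' = ρ),
            (M ^ r)⁻¹ := Finset.sum_congr rfl fun f' hf' => by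
              rw [(Finset.mem_filter.1 hf').2]
      _ ≤ ∑ f' ∈ Finset.univ.filter fun f' : J → κ => ∀ j, ρ (f' j) = ρ (f j), (M ^ r)⁻¹ := by
          refine Finset.sum_le_sum_of_subset_of_nonneg (fun f' hf' => ?_)
            fun _ _ _ => by positivity
          have h1 : fiberRep f f' = ρ := (Finset.mem_filter.1 hf').2
          exact Finset.mem_filter.2 ⟨Finset.mem_univ _, h1 ▸ fiberRep_apply_eq f f'⟩
      _ = (∏ a, ((Finset.univ.filter fun b => ρ b = ρ a).card : ℝ)) ^ q * (M ^ r)⁻¹ := by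
          rw [Finset.sum_const, nsmul_eq_mul, card_comp_eq_comp hf ρ]
          push_cast
          rfl
      _ ≤ (c ^ r) ^ q * ((C * c ^ q) ^ r)⁻¹ := by
          have h1 := Finset.prod_card_fiber_le hc hidem hsize
          exact mul_le_mul (pow_le_pow_left₀ (Finset.prod_nonneg fun _ _ => Nat.cast_nonneg _)
            h1 q) (inv_anti₀ (by positivity) (pow_le_pow_left₀ (by positivity) hM r))
            (by positivity) (by positivity)
      _ ≤ C⁻¹ := by
          rw [mul_pow, ← pow_mul, ← pow_mul, mul_comm q r, mul_inv, mul_left_comm]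
          refine (mul_le_of_le_one_right (by positivity) mul_inv_le_one).trans ?_
          exact inv_anti₀ hC0 (le_self_pow₀ hC (by omega))
  calc _ ≤ ∑ _ρ : κ → κ, C⁻¹ := Finset.sum_le_sum fun ρ _ => hterm ρ
    _ = _ := by
      rw [Finset.sum_const, nsmul_eq_mul, Finset.card_univ, Fintype.card_fun, div_eq_mul_inv]
      push_cast
      rfl

/-! ### Hashing to a free family -/

/-- A family of vectors such that choosing one vector for each coordinate gives a zero-sum vector
exactly when all choices agree. -/
def IsSumFree {B κ G : Type} [Fintype κ] [AddCommGroup G] (β : B → κ → G) : Prop :=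
  (∀ b, ∑ i, β b i = 0) ∧ ∀ b : κ → B, ∑ i, β (b i) i = 0 → ∀ i j, b i = b j

theorem IsSumFree.injective {B κ G : Type} [Fintype κ] [DecidableEq κ] [Nontrivial κ]
    [AddCommGroup G] {β : B → κ → G} (hβ : IsSumFree β) (i : κ) :
    Function.Injective fun b => β b i := by
  intro b b' h
  obtain ⟨j, hj⟩ := exists_ne i
  have := hβ.2 (Function.update (fun _ => b') i b) (by
    rw [← hβ.1 b']
    refine Finset.sum_congr rfl fun l _ => ?_
    rcases eq_or_ne l i with rfl | hl
    · simpa using h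
    · simp [hl]) i j
  simpa [hj] using this

/-- Every fiber of the labelling `f` is hashed to the corresponding entry of `v`. -/
def Hits {J κ G : Type} [Fintype J] [DecidableEq κ] [AddCommGroup G]
    (ω : (κ → G) × (J → G)) (f : J → κ) (v : κ → G) : Prop :=
  ∀ i, ω.1 i + ∑ j with f j = i, ω.2 j = v i

open Classical in
/-- Among the balanced labellings there is a large family that is free: any two of them differ in
all fibers, and a labelling whose fibers all occur in the family belongs to it. -/
theorem exists_free_balanced {J κ G B : Type} [Fintype J] [Fintype κ] [Fintype G] [Fintype B]
    [AddCommGroup G] {q n : ℕ} {c : ℝ} {β : B → κ → G} (hβ : IsSumFree β)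
    (hκ : Fintype.card κ = n + 1) (hn : 1 ≤ n) (hc0 : 0 < c)
    (hc : ∀ s : ℕ, 1 ≤ s → s ≤ n → (s : ℝ) ^ s ≤ c ^ (s - 1))
    (hG : 2 * (Fintype.card κ : ℝ) ^ Fintype.card κ * c ^ q ≤ Fintype.card G) :
    ∃ Φ : Finset (J → κ),
      ((balanced J κ q).card : ℝ) * Fintype.card B ≤ 2 * (Fintype.card G : ℝ) ^ n * Φ.card ∧
      (∀ f ∈ Φ, ∀ f' ∈ Φ, SharesFiber f f' → f = f') ∧
      ∀ a : J → κ, (∀ i, ∃ f ∈ Φ, ∀ j, a j = i ↔ f j = i) → a ∈ Φ := by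
  have : Nontrivial κ := Fintype.one_lt_card_iff_nontrivial.1 (by omega)
  obtain ⟨i₀, -, -⟩ := exists_pair_ne κ
  set P := balanced J κ q with hP
  let bad : (J → κ) → Finset (J → κ) := fun f => P.filter fun f' => f' ≠ f ∧ SharesFiber f f'
  let good : (κ → G) × (J → G) → (J → κ) → B → Prop := fun ω f b =>
    Hits ω f (β b) ∧ ∀ f' ∈ bad f, ¬ Hits ω f' (β b)
  -- The hashes of the fibers of any labelling then sum to zero, which is what the sum-free property
  -- acts on.
  let Ω : Finset ((κ → G) × (J → G)) := Finset.univ.filter fun ω => ∑ i, ω.1 i + ∑ j, ω.2 j = 0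
  have hsum : ∀ (ω : (κ → G) × (J → G)) (f : J → κ),
      ∑ i, (ω.1 i + ∑ j with f j = i, ω.2 j) = ∑ i, ω.1 i + ∑ j, ω.2 j := fun ω f => by
    rw [Finset.sum_add_distrib]
    congr 1
    exact Finset.sum_fiberwise Finset.univ f ω.2
  have hΩ : ∀ ω f b, Hits ω f (β b) → ω ∈ Ω := fun ω f b h => by
    simp only [Ω, Finset.mem_filter, Finset.mem_univ, true_and]
    rw [← hsum ω f, ← hβ.1 b]
    exact Finset.sum_congr rfl fun i _ => h i
  have hM0 : (0 : ℝ) < Fintype.card G := Nat.cast_pos.2 Fintype.card_pos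
  have hΩcard : Ω.card ≤ Fintype.card G ^ n * Fintype.card G ^ Fintype.card J := by
    have h1 : Ω.card ≤ Fintype.card (({i : κ // i ≠ i₀} → G) × (J → G)) := by
      rw [← Finset.card_univ]
      refine Finset.card_le_card_of_injOn (fun ω => (fun i => ω.1 i, ω.2))
        (fun _ _ => Finset.mem_coe.2 (Finset.mem_univ _)) ?_
      rintro ⟨u, w⟩ hω ⟨u', w'⟩ hω' h
      have hw : w = w' := congrArg Prod.snd h
      have hu : ∀ i, i ≠ i₀ → u i = u' i := fun i hi => congrFun (congrArg Prod.fst h) ⟨i, hi⟩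
      subst hw
      have h2 : ∑ i, u i + ∑ j, w j = 0 := (Finset.mem_filter.1 hω).2
      have h3 : ∑ i, u' i + ∑ j, w j = 0 := (Finset.mem_filter.1 hω').2
      have h4 : ∑ i, u i = ∑ i, u' i := add_right_cancel (h2.trans h3.symm)
      rw [← Finset.add_sum_erase _ _ (Finset.mem_univ i₀),
        ← Finset.add_sum_erase _ u' (Finset.mem_univ i₀),
        Finset.sum_congr rfl fun i hi => hu i (Finset.ne_of_mem_erase hi)] at h4
      congr 1
      ext i
      rcases eq_or_ne i i₀ with rfl | hi
      · exact add_right_cancel h4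
      · exact hu i hi
    rwa [Fintype.card_prod, Fintype.card_fun, Fintype.card_fun, Fintype.card_subtype_compl,
      Fintype.card_subtype_eq, hκ, Nat.add_sub_cancel] at h1
  have hhit : ∀ f b, Fintype.card G ^ Fintype.card J ≤ (Ω.filter fun ω => Hits ω f (β b)).card := by
    intro f b
    rw [← Fintype.card_fun, ← Finset.card_univ]
    refine Finset.card_le_card_of_injOn
      (fun w => (fun i => β b i - ∑ j with f j = i, w j, w)) (fun w _ => ?_)
      fun w _ w' _ h => congrArg Prod.snd h
    have : Hits (fun i => β b i - ∑ j with f j = i, w j, w) f (β b) := fun i => sub_add_cancel _ _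
    exact Finset.mem_coe.2 (Finset.mem_filter.2 ⟨hΩ _ f b this, this⟩)
  -- If both labellings hit `β b`, their fiber sums of `w` agree, and `w` determines the offsets
  -- `u`.
  have hpair : ∀ f f' b, ((Ω.filter fun ω => Hits ω f (β b) ∧ Hits ω f' (β b)).card : ℝ) ≤
      (Fintype.card G : ℝ) ^ Fintype.card J *
        ((Fintype.card G : ℝ) ^ (Finset.univ.filter fun a => fiberRep f f' a ≠ a).card)⁻¹ := by
    intro f f' b
    rw [← div_eq_mul_inv, le_div_iff₀ (by positivity), ← Nat.cast_pow (Fintype.card G)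
      (Fintype.card J)]
    have h1 := card_fiberSum_eq_mul_le (G := G) f f'
    refine le_trans ?_ (Nat.cast_le.2 h1)
    push_cast
    gcongr
    rw [Nat.card_eq_fintype_card, ← Fintype.card_coe]
    refine Fintype.card_le_of_injective (fun ω => ⟨ω.1.2, fun i => ?_⟩) ?_
    · have h2 := (Finset.mem_filter.1 ω.2).2
      exact add_left_cancel ((h2.2 i).trans (h2.1 i).symm)
    · rintro ⟨⟨u, w⟩, hω⟩ ⟨⟨u', w'⟩, hω'⟩ h
      have hw : w = w' := congrArg Subtype.val h
      subst hw
      have hu : u = u' := by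
        ext i
        exact add_right_cancel (((Finset.mem_filter.1 hω).2.1 i).trans
          ((Finset.mem_filter.1 hω').2.1 i).symm)
      subst hu
      rfl
  have hgood : ∀ f ∈ P, ∀ b, (Fintype.card G : ℝ) ^ Fintype.card J / 2 ≤
      (Ω.filter fun ω => good ω f b).card := by
    intro f hf b
    have hsub : (Ω.filter fun ω => Hits ω f (β b)) ⊆ (Ω.filter fun ω => good ω f b) ∪
        (bad f).biUnion fun f' => Ω.filter fun ω => Hits ω f (β b) ∧ Hits ω f' (β b) := by
      intro ω hω
      rw [Finset.mem_filter] at hω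
      by_cases h : ∀ f' ∈ bad f, ¬ Hits ω f' (β b)
      · exact Finset.mem_union_left _ (Finset.mem_filter.2 ⟨hω.1, hω.2, h⟩)
      · push Not at h
        obtain ⟨f', hf', hh⟩ := h
        exact Finset.mem_union_right _ (Finset.mem_biUnion.2
          ⟨f', hf', Finset.mem_filter.2 ⟨hω.1, hω.2, hh⟩⟩)
    have h1 := (hhit f b).trans ((Finset.card_le_card hsub).trans ((Finset.card_union_le _ _).trans
      (Nat.add_le_add_left Finset.card_biUnion_le _)))
    have h2 : (Fintype.card G : ℝ) ^ Fintype.card J ≤ (Ω.filter fun ω => good ω f b).card +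
        ∑ f' ∈ bad f, ((Ω.filter fun ω => Hits ω f (β b) ∧ Hits ω f' (β b)).card : ℝ) := by
      exact_mod_cast h1
    have h3 := Finset.sum_le_sum fun f' (_ : f' ∈ bad f) => hpair f f' b
    rw [← Finset.mul_sum] at h3
    have hkk : (1 : ℝ) ≤ (Fintype.card κ : ℝ) ^ Fintype.card κ :=
      one_le_pow₀ (by rw [hκ]; push_cast; linarith [Nat.cast_nonneg (α := ℝ) n])
    have h4 := sum_inv_pow_card_le hκ hn hc (by linarith) hc0 hG hf
    rw [mul_comm (2 : ℝ), div_mul_cancel_left₀ (by positivity)] at h4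
    have h5 := mul_le_mul_of_nonneg_left h4
      (by positivity : (0 : ℝ) ≤ (Fintype.card G : ℝ) ^ Fintype.card J)
    linarith
  have hne : Ω.Nonempty := ⟨0, by simp [Ω]⟩
  -- First moment: each pair (f, b) is good for at least |G|^|J| / 2 of the at most |G|^(n+|J|)
  -- hashes.
  obtain ⟨ω, -, hω⟩ : ∃ ω ∈ Ω, (P.card : ℝ) * Fintype.card B ≤ 2 * (Fintype.card G : ℝ) ^ n *
      ((P ×ˢ (Finset.univ : Finset B)).filter fun x => good ω x.1 x.2).card := by
    refine Finset.exists_le_of_sum_le hne ?_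
    rw [Finset.sum_const, nsmul_eq_mul, ← Finset.mul_sum]
    have h1 : (P.card : ℝ) * Fintype.card B * ((Fintype.card G : ℝ) ^ Fintype.card J / 2) ≤
        ∑ ω ∈ Ω, (((P ×ˢ (Finset.univ : Finset B)).filter
          fun x => good ω x.1 x.2).card : ℝ) := by
      have h2 : ∑ ω ∈ Ω, ((P ×ˢ (Finset.univ : Finset B)).filter
          fun x => good ω x.1 x.2).card = ∑ x ∈ P ×ˢ (Finset.univ : Finset B),
            (Ω.filter fun ω => good ω x.1 x.2).card :=
        Finset.sum_card_bipartiteAbove_eq_sum_card_bipartiteBelow _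
      rw [← Nat.cast_sum, h2, Nat.cast_sum]
      calc _ = ∑ x ∈ P ×ˢ (Finset.univ : Finset B),
            ((Fintype.card G : ℝ) ^ Fintype.card J / 2) := by
              rw [Finset.sum_const, nsmul_eq_mul, Finset.card_product, Finset.card_univ]
              push_cast
              rfl
        _ ≤ _ := Finset.sum_le_sum fun x hx => hgood x.1 (Finset.mem_product.1 hx).1 x.2
    have h2 : (Ω.card : ℝ) ≤ (Fintype.card G : ℝ) ^ n * (Fintype.card G : ℝ) ^ Fintype.card J := by
      exact_mod_cast hΩcard
    calc _ ≤ ((Fintype.card G : ℝ) ^ n * (Fintype.card G : ℝ) ^ Fintype.card J) *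
          ((P.card : ℝ) * Fintype.card B) := by gcongr
      _ = 2 * (Fintype.card G : ℝ) ^ n *
          ((P.card : ℝ) * Fintype.card B * ((Fintype.card G : ℝ) ^ Fintype.card J / 2)) := by ring
      _ ≤ _ := by gcongr
  -- A common fiber has a common hash, which forces b = b' because one coordinate determines the
  -- vector.
  have hmem : ∀ {f f' b b'}, good ω f b → f' ∈ P → Hits ω f' (β b') → SharesFiber f f' →
      f' = f := by
    intro f f' b b' hf hf' hh hs
    obtain ⟨i, hi⟩ := hs
    have hb : b = b' := hβ.injective i (by
      change β b i = β b' i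
      rw [← hf.1 i, ← hh i]
      simp only [hi])
    subst hb
    by_contra hne
    exact hf.2 f' (Finset.mem_filter.2 ⟨hf', hne, i, hi⟩) hh
  refine ⟨P.filter fun f => ∃ b, good ω f b, hω.trans ?_, ?_, ?_⟩
  · gcongr
    refine Finset.card_le_card_of_injOn Prod.fst (fun x hx => ?_) ?_
    · have hx := Finset.mem_filter.1 (Finset.mem_coe.1 hx)
      exact Finset.mem_coe.2 (Finset.mem_filter.2 ⟨(Finset.mem_product.1 hx.1).1, x.2, hx.2⟩)
    · rintro ⟨f, b⟩ hx ⟨f', b'⟩ hx' h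
      obtain rfl : f = f' := h
      have h1 := (Finset.mem_filter.1 (Finset.mem_coe.1 hx)).2
      have h2 := (Finset.mem_filter.1 (Finset.mem_coe.1 hx')).2
      have hb : b = b' := hβ.injective i₀ ((h1.1 i₀).symm.trans (h2.1 i₀))
      rw [hb]
  · intro f hf f' hf' hs
    obtain ⟨hfP, b, hb⟩ := Finset.mem_filter.1 hf
    obtain ⟨hfP', b', hb'⟩ := Finset.mem_filter.1 hf'
    exact (hmem hb hfP' hb'.1 hs).symm
  · intro a ha
    choose f hf haf using ha
    choose hfP b hb using fun i => Finset.mem_filter.1 (hf i)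
    have haP : a ∈ P := by
      refine mem_balanced.2 fun i => ?_
      rw [← mem_balanced.1 (hfP i) i]
      simp only [haf i]
    have hab : ∀ i, ω.1 i + ∑ j with a j = i, ω.2 j = β (b i) i := fun i => by
      rw [← (hb i).1 i]
      simp only [haf i]
    have hzero : ∑ i, β (b i) i = 0 := by
      rw [← Finset.sum_congr rfl fun i _ => hab i, hsum]
      exact (Finset.mem_filter.1 (hΩ ω _ _ (hb i₀).1)).2
    have hconst := hβ.2 b hzero
    have hahit : Hits ω a (β (b i₀)) := fun i => by rw [hab i, hconst i i₀]
    rw [hmem (hb i₀) haP hahit ⟨i₀, fun j => (haf i₀ j).symm⟩]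
    exact hf i₀

/-! ### Sizes of the balanced and sum-free families -/

/-- Some label-count vector is shared by at least a (q+1)^{-(n+1)} fraction of the words of length
q. Concatenating n + 1 such words, the s-th shifted cyclically by s, gives a balanced labelling. -/
theorem pow_le_card_balanced_mul {J : Type} [Fintype J] [DecidableEq J] {n q : ℕ}
    (e : J ≃ Fin q × Fin (n + 1)) :
    (n + 1) ^ (q * (n + 1)) ≤
      (balanced J (Fin (n + 1)) q).card * (q + 1) ^ ((n + 1) * (n + 1)) := by
  classical
  let τ : (Fin q → Fin (n + 1)) → Fin (n + 1) → Fin (q + 1) := fun f i =>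
    ⟨(Finset.univ.filter fun x => f x = i).card,
      Nat.lt_succ_of_le ((Finset.card_le_univ _).trans (by simp))⟩
  obtain ⟨y, -, hy⟩ := Finset.exists_le_of_sum_le
    (s := (Finset.univ : Finset (Fin (n + 1) → Fin (q + 1))))
    (f := fun _ => (n + 1) ^ q)
    (g := fun y => (Finset.univ.filter fun f => τ f = y).card * (q + 1) ^ (n + 1))
    Finset.univ_nonempty (by
      rw [← Finset.sum_mul, ← Finset.card_eq_sum_card_fiberwise (f := τ) (s := Finset.univ)
        (t := Finset.univ) fun _ _ => Finset.mem_coe.2 (Finset.mem_univ _)]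
      simp [mul_comm])
  let T := {f // τ f = y}
  have hT : (n + 1) ^ q ≤ Fintype.card T * (q + 1) ^ (n + 1) := by
    rw [Fintype.card_subtype]
    exact hy
  let F : (Fin (n + 1) → T) → J → Fin (n + 1) := fun t j => (t (e j).2).1 (e j).1 + (e j).2
  have hF : ∀ t, F t ∈ balanced J (Fin (n + 1)) q := by
    intro t
    refine mem_balanced.2 fun i => ?_
    have hcount : ∀ s c, (Finset.univ.filter fun x => (t s).1 x = c).card = y c := fun s c =>
      congrArg Fin.val (congrFun (t s).2 c)
    calc (Finset.univ.filter fun j => F t j = i).card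
        = ∑ j, if F t j = i then 1 else 0 := by rw [Finset.card_filter]
      _ = ∑ p : Fin q × Fin (n + 1), if (t p.2).1 p.1 + p.2 = i then 1 else 0 :=
          e.sum_comp fun p => if (t p.2).1 p.1 + p.2 = i then 1 else 0
      _ = ∑ s, ∑ x, if (t s).1 x = i - s then 1 else 0 := by
          rw [Fintype.sum_prod_type_right]
          simp only [eq_sub_iff_add_eq]
      _ = ∑ s, (y (i - s) : ℕ) := by
          exact Finset.sum_congr rfl fun s _ => by rw [← hcount s, Finset.card_filter]
      _ = ∑ c, (y c : ℕ) := (Equiv.subLeft i).sum_comp fun c => (y c : ℕ)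
      _ = ∑ c, (Finset.univ.filter fun x => (t 0).1 x = c).card := by simp only [hcount]
      _ = q := by
          rw [← Finset.card_eq_sum_card_fiberwise (f := (t 0).1) (s := Finset.univ)
            (t := Finset.univ) fun _ _ => Finset.mem_coe.2 (Finset.mem_univ _)]
          simp
  have hinj : Function.Injective F := by
    intro t t' h
    ext s x : 3
    have := congrFun h (e.symm (x, s))
    simpa [F] using this
  have hcard : Fintype.card T ^ (n + 1) ≤ (balanced J (Fin (n + 1)) q).card := by
    have := Finset.card_le_card_of_injOn (s := Finset.univ) (t := balanced J (Fin (n + 1)) q) F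
      (fun t _ => Finset.mem_coe.2 (hF t)) hinj.injOn
    simpa using this
  calc (n + 1) ^ (q * (n + 1)) = ((n + 1) ^ q) ^ (n + 1) := pow_mul _ _ _
    _ ≤ (Fintype.card T * (q + 1) ^ (n + 1)) ^ (n + 1) := Nat.pow_le_pow_left hT _
    _ = Fintype.card T ^ (n + 1) * (q + 1) ^ ((n + 1) * (n + 1)) := by rw [mul_pow, ← pow_mul]
    _ ≤ _ := Nat.mul_le_mul_right _ hcard

/-- Vectors of fixed length with small entries form a large sum-free family. -/
theorem exists_isSumFree (n d t : ℕ) (hn : 1 ≤ n) :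
    ∃ (B : Type) (_ : Fintype B) (β : B → Fin (n + 1) → Fin t → ZMod (n * d)),
      IsSumFree β ∧ d ^ t ≤ Fintype.card B * (t * d ^ 2 + 1) := by
  classical
  let N : (Fin t → Fin d) → ℕ := fun x => ∑ j, (x j : ℕ) ^ 2
  have hN : ∀ x, N x ∈ Finset.range (t * d ^ 2 + 1) := fun x => by
    rw [Finset.mem_range, Nat.lt_succ_iff]
    calc N x ≤ ∑ _j : Fin t, d ^ 2 :=
          Finset.sum_le_sum fun j _ => Nat.pow_le_pow_left (x j).2.le 2
      _ = t * d ^ 2 := by simp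
  obtain ⟨v, -, hv⟩ := Finset.exists_le_of_sum_le
    (s := Finset.range (t * d ^ 2 + 1)) (f := fun _ => d ^ t)
    (g := fun v => (Finset.univ.filter fun x => N x = v).card * (t * d ^ 2 + 1))
    ⟨0, by simp⟩ (by
      rw [← Finset.sum_mul, ← Finset.card_eq_sum_card_fiberwise (f := N) (s := Finset.univ)
        fun x _ => Finset.mem_coe.2 (hN x)]
      simp [mul_comm])
  -- Behrend's construction: points of a most popular sphere, with x sent to (−n x, x, …, x).
  refine ⟨{x // N x = v}, inferInstance, fun x => Fin.cons (fun j => -(n * (x.1 j : ℕ)))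
    fun _ j => ((x.1 j : ℕ) : ZMod (n * d)), ⟨fun x => ?_, fun b hb => ?_⟩, ?_⟩
  · ext j
    simp [Fin.sum_univ_succ]
  · have key : ∀ j, ∑ i : Fin n, ((b i.succ).1 j : ℕ) = n * ((b 0).1 j : ℕ) := by
      intro j
      have h1 := congrFun hb j
      rw [Fin.sum_univ_succ] at h1
      simp only [Fin.cons_zero, Fin.cons_succ, Pi.add_apply, Finset.sum_apply,
        Pi.zero_apply] at h1
      have h2 : ((∑ i : Fin n, ((b i.succ).1 j : ℕ) : ℕ) : ZMod (n * d)) =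
          ((n * ((b 0).1 j : ℕ) : ℕ) : ZMod (n * d)) := by
        push_cast
        linear_combination h1
      -- Both sides are below n d, so the congruence is an equality of integers.
      rw [ZMod.natCast_eq_natCast_iff', Nat.mod_eq_of_lt, Nat.mod_eq_of_lt] at h2
      · exact h2
      · exact Nat.mul_lt_mul_of_pos_left ((b 0).1 j).2 hn
      · calc ∑ i : Fin n, ((b i.succ).1 j : ℕ) < ∑ _i : Fin n, d :=
              Finset.sum_lt_sum_of_nonempty ⟨⟨0, hn⟩, Finset.mem_univ _⟩
                fun i _ => ((b i.succ).1 j).2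
          _ = n * d := by simp
    -- `b 0` is the mean of points on the same sphere, so their variance vanishes.
    have hsq : ∑ i : Fin n, ∑ j, (((b i.succ).1 j : ℤ) - ((b 0).1 j : ℤ)) ^ 2 = 0 := by
      have hnorm : ∀ i, ∑ j, ((b i).1 j : ℤ) ^ 2 = v := fun i => by
        exact_mod_cast (b i).2
      have key' : ∀ j, ∑ i : Fin n, ((b i.succ).1 j : ℤ) = n * ((b 0).1 j : ℤ) := fun j => by
        exact_mod_cast key j
      calc _ = ∑ i : Fin n, ∑ j, ((b i.succ).1 j : ℤ) ^ 2
            - 2 * ∑ j, ((b 0).1 j : ℤ) * ∑ i : Fin n, ((b i.succ).1 j : ℤ)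
            + n * ∑ j, ((b 0).1 j : ℤ) ^ 2 := by
              simp only [Finset.mul_sum]
              rw [Finset.sum_comm (s := (Finset.univ : Finset (Fin t)))
                (t := (Finset.univ : Finset (Fin n))), ← Finset.sum_sub_distrib]
              have : ∑ j, (n : ℤ) * ((b 0).1 j : ℤ) ^ 2 =
                  ∑ _i : Fin n, ∑ j, ((b 0).1 j : ℤ) ^ 2 := by
                simp [Finset.mul_sum]
              rw [this, ← Finset.sum_add_distrib]
              refine Finset.sum_congr rfl fun i _ => ?_
              rw [← Finset.sum_sub_distrib, ← Finset.sum_add_distrib]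
              exact Finset.sum_congr rfl fun j _ => by ring
        _ = n * v - 2 * (n * v) + n * v := by
              simp only [key', hnorm]
              have : ∑ j, ((b 0).1 j : ℤ) * (n * ((b 0).1 j : ℤ)) = n * v := by
                rw [← hnorm 0, Finset.mul_sum]
                exact Finset.sum_congr rfl fun j _ => by ring
              rw [this]
              simp
        _ = 0 := by ring
    have hall : ∀ i : Fin (n + 1), b i = b 0 := by
      refine Fin.cases rfl fun i => ?_
      rw [Finset.sum_eq_zero_iff_of_nonneg
        fun i _ => Finset.sum_nonneg fun j _ => sq_nonneg _] at hsq
      have h1 := hsq i (Finset.mem_univ _)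
      rw [Finset.sum_eq_zero_iff_of_nonneg fun j _ => sq_nonneg _] at h1
      ext j
      have h2 := pow_eq_zero_iff (two_ne_zero) |>.1 (h1 j (Finset.mem_univ _))
      omega
    exact fun i j => (hall i).trans (hall j).symm
  · rw [Fintype.card_subtype]
    exact hv

/-! ### Asymptotic size of the free family -/

/-- For n ≥ 2 take c = n^{n/(n-1)}: the convex function s log s lies below its chord on [1, n]. -/
theorem exists_pow_le_pow_pred (n : ℕ) (hn : 1 ≤ n) :
    ∃ c : ℝ, 1 ≤ c ∧ c ^ (n - 1) = (n : ℝ) ^ n ∧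
      ∀ s : ℕ, 1 ≤ s → s ≤ n → (s : ℝ) ^ s ≤ c ^ (s - 1) := by
  rcases hn.eq_or_lt with rfl | hn
  · refine ⟨1, le_rfl, by simp, fun s h1 h2 => ?_⟩
    obtain rfl : s = 1 := le_antisymm h2 h1
    simp
  have hn1 : (0 : ℝ) < n - 1 := by
    have : (1 : ℝ) < n := by exact_mod_cast hn
    linarith
  have hlog : 0 ≤ Real.log n := Real.log_natCast_nonneg n
  refine ⟨Real.exp (n * Real.log n / (n - 1)), Real.one_le_exp (by positivity), ?_, fun s h1 h2 => ?_⟩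
  · rw [← Real.exp_nat_mul, Nat.cast_sub hn.le, Nat.cast_one, mul_div_cancel₀ _ hn1.ne',
      Real.exp_nat_mul, Real.exp_log (by positivity)]
  · have hs : (0 : ℝ) < s := by exact_mod_cast h1
    have hs1 : (1 : ℝ) ≤ s := by exact_mod_cast h1
    have hsn : (s : ℝ) ≤ n := by exact_mod_cast h2
    have h := Real.convexOn_mul_log.2 (Set.mem_Ici.2 (zero_le_one' ℝ))
      (Set.mem_Ici.2 (Nat.cast_nonneg (α := ℝ) n))
      (div_nonneg (sub_nonneg.2 hsn) hn1.le) (div_nonneg (sub_nonneg.2 hs1) hn1.le)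
      (by field_simp; ring)
    have hcomb : ((n : ℝ) - s) / (n - 1) * 1 + (s - 1) / (n - 1) * n = s := by field_simp; ring
    simp only [smul_eq_mul, hcomb, Real.log_one, mul_zero, zero_add] at h
    rw [← Real.exp_nat_mul, Nat.cast_sub h1, Nat.cast_one,
      show (s : ℝ) ^ s = Real.exp (s * Real.log s) by rw [Real.exp_nat_mul, Real.exp_log hs]]
    exact Real.exp_le_exp.2 (h.trans (le_of_eq (by ring)))

theorem exists_free_log_card_ge (n : ℕ) (hn : 1 ≤ n) {η : ℝ} (hη : 0 < η) :
    ∃ D : ℝ, ∀ q : ℕ, ∃ Φ : Finset (Fin (q * (n + 1)) → Fin (n + 1)),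
      0 < Φ.card ∧
      q * ((n + 1) * Real.log (n + 1) - n * Real.log n - η) -
        ((n + 1) * (n + 1) + 1) * Real.log (q + 1) - D ≤ Real.log Φ.card ∧
      (∀ f ∈ Φ, ∀ f' ∈ Φ, SharesFiber f f' → f = f') ∧
      ∀ a, (∀ i, ∃ f ∈ Φ, ∀ j, a j = i ↔ f j = i) → a ∈ Φ := by
  obtain ⟨c, hc1, hcn, hc⟩ := exists_pow_le_pow_pred n hn
  have hn0 : (1 : ℝ) ≤ n := by exact_mod_cast hn
  have hLn : 0 ≤ Real.log n := Real.log_nonneg hn0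
  have hLc : 0 ≤ Real.log c := Real.log_nonneg hc1
  -- The sum-free family has about d^t elements in a group of order (n d)^t. With t ≈ q log c / log
  -- (n d), this choice keeps the loss n^t below e^{qη} up to a constant.
  obtain ⟨d, hd2, hd⟩ : ∃ d : ℕ, 2 ≤ d ∧ Real.log n * Real.log c ≤ η * Real.log d := by
    obtain ⟨d, hd⟩ := exists_nat_ge (Real.exp (Real.log n * Real.log c / η))
    refine ⟨max 2 d, le_max_left _ _, ?_⟩
    have h1 : Real.exp (Real.log n * Real.log c / η) ≤ (max 2 d : ℕ) :=
      hd.trans (by exact_mod_cast le_max_right 2 d)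
    have h2 := (Real.le_log_iff_exp_le ((Real.exp_pos _).trans_le h1)).2 h1
    rwa [div_le_iff₀' hη] at h2
  have hd2' : (2 : ℝ) ≤ d := by exact_mod_cast hd2
  set C : ℝ := 2 * ((n + 1 : ℕ) : ℝ) ^ (n + 1) with hC
  have hC1 : 1 ≤ C := by
    have : (1 : ℝ) ≤ ((n + 1 : ℕ) : ℝ) ^ (n + 1) := one_le_pow₀ (by push_cast; linarith)
    linarith
  have hLC : 0 ≤ Real.log C := Real.log_nonneg hC1
  set y : ℝ := n * d with hy
  have hy2 : 2 ≤ y := by nlinarith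
  have hLy : Real.log y = Real.log n + Real.log d :=
    Real.log_mul (by positivity) (by positivity)
  have hLd : Real.log 2 ≤ Real.log d := Real.log_le_log (by norm_num) hd2'
  have hL2 : 0 < Real.log 2 := Real.log_pos (by norm_num)
  set A : ℝ := d ^ 2 * (1 + (Real.log C + Real.log c) / Real.log 2) + 1 with hA
  have hA1 : 1 ≤ A := by
    have : 0 ≤ (d : ℝ) ^ 2 * (1 + (Real.log C + Real.log c) / Real.log 2) := by positivity
    linarith
  refine ⟨Real.log n + Real.log C + Real.log A + Real.log 2 +
    (n - 1) * (Real.log y + Real.log C), fun q => ?_⟩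
  have hq0 : (0 : ℝ) ≤ q := Nat.cast_nonneg q
  have hx1 : 1 ≤ C * c ^ q := one_le_mul_of_one_le_of_one_le hC1 (one_le_pow₀ hc1)
  -- Dimension s + 1 is the least for which the group is guaranteed to exceed C c^q, so the excess
  -- is at most a factor y.
  obtain ⟨s, hs1, hs2⟩ := exists_nat_pow_near hx1 (by linarith : 1 < y)
  obtain ⟨B, _, β, hβ, hB⟩ := exists_isSumFree n d (s + 1) hn
  have : NeZero (n * d) := ⟨by positivity⟩
  have hcardG : (Fintype.card (Fin (s + 1) → ZMod (n * d)) : ℝ) = y ^ (s + 1) := by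
    rw [Fintype.card_fun, ZMod.card, Fintype.card_fin]
    push_cast
    rfl
  obtain ⟨Φ, hΦ1, hΦ2, hΦ3⟩ := exists_free_balanced (J := Fin (q * (n + 1))) (q := q) hβ
    (Fintype.card_fin _) hn (by linarith) hc (by
      rw [hcardG, Fintype.card_fin]
      exact hs2.le)
  rw [hcardG] at hΦ1
  have hP := pow_le_card_balanced_mul (n := n) (q := q) finProdFinEquiv.symm
  have hPpos : 0 < (balanced (Fin (q * (n + 1))) (Fin (n + 1)) q).card :=
    Nat.pos_of_mul_pos_right (lt_of_lt_of_le (by positivity) hP)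
  have hBpos : 0 < Fintype.card B :=
    Nat.pos_of_mul_pos_right (lt_of_lt_of_le (by positivity) hB)
  set P := (balanced (Fin (q * (n + 1))) (Fin (n + 1)) q).card
  have hPpos' : (0 : ℝ) < P := by exact_mod_cast hPpos
  have hBpos' : (0 : ℝ) < Fintype.card B := by exact_mod_cast hBpos
  have hΦpos : 0 < Φ.card := by
    rw [Nat.pos_iff_ne_zero]
    intro h
    rw [h, Nat.cast_zero, mul_zero] at hΦ1
    exact absurd (mul_pos hPpos' hBpos') (not_lt.2 hΦ1)
  have hΦpos' : (0 : ℝ) < Φ.card := by exact_mod_cast hΦpos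
  refine ⟨Φ, hΦpos, ?_, hΦ2, hΦ3⟩
  have e1 : q * (n + 1) * Real.log (n + 1) ≤
      Real.log P + (n + 1) * (n + 1) * Real.log (q + 1) := by
    have h : ((n : ℝ) + 1) ^ (q * (n + 1)) ≤ P * ((q : ℝ) + 1) ^ ((n + 1) * (n + 1)) := by
      exact_mod_cast hP
    have := Real.log_le_log (by positivity) h
    rw [Real.log_pow, Real.log_mul (by positivity) (by positivity), Real.log_pow] at this
    push_cast at this
    exact this
  have e2 : (s + 1) * Real.log d ≤
      Real.log (Fintype.card B) + Real.log ((s + 1) * d ^ 2 + 1) := by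
    have h : (d : ℝ) ^ (s + 1) ≤ Fintype.card B * (((s : ℝ) + 1) * d ^ 2 + 1) := by
      exact_mod_cast hB
    have := Real.log_le_log (by positivity) h
    rw [Real.log_pow, Real.log_mul (by positivity) (by positivity)] at this
    push_cast at this
    exact this
  have e3 : Real.log P + Real.log (Fintype.card B) ≤
      Real.log 2 + n * ((s + 1) * Real.log y) + Real.log Φ.card := by
    have := Real.log_le_log (by positivity) hΦ1
    rw [Real.log_mul (by positivity) (by positivity), Real.log_mul (by positivity) (by positivity),
      Real.log_mul (by positivity) (by positivity), Real.log_pow, Real.log_pow] at this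
    push_cast at this
    exact this
  have e4 : s * Real.log y ≤ Real.log C + q * Real.log c := by
    clear_value y
    have := Real.log_le_log (by positivity) hs1
    rwa [Real.log_pow, Real.log_mul (by positivity) (by positivity), Real.log_pow] at this
  have e5 : (n - 1) * Real.log c = n * Real.log n := by
    have := congrArg Real.log hcn
    rwa [Real.log_pow, Real.log_pow, Nat.cast_sub hn, Nat.cast_one] at this
  have hs0 : (0 : ℝ) ≤ s := Nat.cast_nonneg s
  have hLypos : 0 < Real.log y := by linarith
  have e6 : s * Real.log n ≤ Real.log C + q * η := by
    refine le_of_mul_le_mul_right ?_ hLypos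
    calc s * Real.log n * Real.log y = Real.log n * (s * Real.log y) := by ring
      _ ≤ Real.log n * (Real.log C + q * Real.log c) := by gcongr
      _ = Real.log C * Real.log n + q * (Real.log n * Real.log c) := by ring
      _ ≤ Real.log C * Real.log y + q * (η * Real.log y) := by
          have h1 : Real.log n ≤ Real.log y := by linarith
          have h2 : Real.log n * Real.log c ≤ η * Real.log y :=
            hd.trans (mul_le_mul_of_nonneg_left (by linarith) hη.le)
          gcongr
      _ = _ := by ring
  have e7 : Real.log ((s + 1) * d ^ 2 + 1) ≤ Real.log A + Real.log (q + 1) := by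
    rw [← Real.log_mul (by positivity) (by positivity)]
    refine Real.log_le_log (by positivity) ?_
    have h1 : (s : ℝ) ≤ (Real.log C + Real.log c) / Real.log 2 * (q + 1) := by
      rw [div_mul_eq_mul_div, le_div_iff₀ hL2]
      have h2 : s * Real.log 2 ≤ s * Real.log y := by gcongr
      nlinarith [mul_nonneg hLC hq0]
    have h3 : (s : ℝ) + 1 ≤ (1 + (Real.log C + Real.log c) / Real.log 2) * (q + 1) := by
      linarith
    have h4 := mul_le_mul_of_nonneg_right h3 (sq_nonneg (d : ℝ))
    rw [hA]
    linarith
  have e8 : (n - 1) * (s * Real.log y) ≤ (n - 1) * (Real.log C + q * Real.log c) :=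
    mul_le_mul_of_nonneg_left e4 (by linarith)
  have e9 : (n - 1) * (q * Real.log c) = q * (n * Real.log n) := by rw [← e5]; ring
  have e10 : (s : ℝ) * Real.log y = s * Real.log n + s * Real.log d := by rw [hLy]; ring
  linarith

/-! ### Entropy and the two conversion bounds -/

theorem mul_binaryEntropy_inv (n : ℕ) (hn : 1 ≤ n) :
    (n + 1) * (binaryEntropy (1 / ((n + 1 : ℕ) : ℝ)) * Real.log 2) =
      (n + 1) * Real.log (n + 1) - n * Real.log n := by
  have hn0 : (0 : ℝ) < n := by exact_mod_cast hn
  have hL2 : 0 < Real.log 2 := Real.log_pos (by norm_num)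
  have h1 : 1 - 1 / ((n : ℝ) + 1) = n / (n + 1) := by field_simp; ring
  rw [binaryEntropy]
  push_cast
  rw [h1, Real.logb, Real.logb, Real.log_div hn0.ne' (by positivity), one_div, Real.log_inv]
  field_simp
  ring

theorem binaryEntropy_inv_pos (n : ℕ) (hn : 1 ≤ n) :
    0 < binaryEntropy (1 / ((n + 1 : ℕ) : ℝ)) := by
  have h := mul_binaryEntropy_inv n hn
  have hn0 : (1 : ℝ) ≤ n := by exact_mod_cast hn
  have hL2 : 0 < Real.log 2 := Real.log_pos (by norm_num)
  have h1 : Real.log n ≤ Real.log (n + 1) := Real.log_le_log (by linarith) (by linarith)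
  have h2 : 0 < Real.log ((n : ℝ) + 1) := Real.log_pos (by linarith)
  have h3 : 0 < ((n : ℝ) + 1) * Real.log (n + 1) - n * Real.log n := by nlinarith
  rw [← h] at h3
  exact pos_of_mul_pos_left (pos_of_mul_pos_right h3 (by positivity)) hL2.le

namespace PartiteState

theorem fiber_eq_of_indicator_eq {J κ : Type} [DecidableEq κ] {a b : J → κ} {i : κ}
    (h : (fun j => if i = a j then (1 : Fin 2) else 0) = fun j => if i = b j then 1 else 0)
    (j : J) : a j = i ↔ b j = i := by
  have := congrFun h j
  by_cases h1 : i = a j <;> by_cases h2 : i = b j <;> simp_all [eq_comm]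

theorem slocc_W_GHZ (n : ℕ) (hn : 1 ≤ n) {r : ℝ}
    (hr : r < binaryEntropy (1 / ((n + 1 : ℕ) : ℝ))) :
    ∃ Q : ℕ, ∀ q ≥ Q, ∀ l : ℕ, (l : ℝ) ≤ q * (n + 1) * r →
      ((W (n + 1)).tensorPow (q * (n + 1))).SLOCC ((GHZ (n + 1)).tensorPow l) := by
  have hL2 : 0 < Real.log 2 := Real.log_pos (by norm_num)
  set h := binaryEntropy (1 / ((n + 1 : ℕ) : ℝ)) with hh
  -- Half of the available gap; the other half absorbs the logarithmic terms.
  set η : ℝ := (n + 1) * (h - r) * Real.log 2 / 2 with hηdef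
  have hη : 0 < η := by
    have := sub_pos.2 hr
    positivity
  obtain ⟨D, hD⟩ := exists_free_log_card_ge n hn hη
  have hlim : ∀ᶠ q : ℕ in Filter.atTop,
      ((n + 1) * (n + 1) + 1) * Real.log ((q : ℝ) + 1) + D ≤ η * q := by
    -- The extra η offsets evaluating the bound at q + 1 instead of q.
    have h1 : (fun x : ℝ => ((n + 1) * (n + 1) + 1) * Real.log x + (D + η)) =o[Filter.atTop]
        (fun x : ℝ => x) :=
      (Real.isLittleO_log_id_atTop.const_mul_left _).add
        (Asymptotics.isLittleO_const_id_atTop _)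
    have h2 : Filter.Tendsto (fun q : ℕ => (q : ℝ) + 1) Filter.atTop Filter.atTop :=
      Filter.tendsto_atTop_add_const_right _ _ tendsto_natCast_atTop_atTop
    filter_upwards [h2.eventually (h1.bound hη)] with q hq
    rw [Real.norm_eq_abs, Real.norm_eq_abs, abs_of_nonneg (by positivity : (0 : ℝ) ≤ q + 1)] at hq
    linarith [le_abs_self ((((n : ℝ) + 1) * (n + 1) + 1) * Real.log ((q : ℝ) + 1) + (D + η))]
  obtain ⟨Q, hQ⟩ := Filter.eventually_atTop.1 hlim
  refine ⟨Q, fun q hq l hl => ?_⟩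
  obtain ⟨Φ, hpos, hcard, hsep, hfree⟩ := hD q
  have hle : 2 ^ l ≤ Φ.card := by
    have h1 : l * Real.log 2 ≤ Real.log Φ.card := by
      refine le_trans ?_ hcard
      rw [← mul_binaryEntropy_inv n hn, ← hh]
      have h2 := hQ q hq
      have h3 := mul_le_mul_of_nonneg_right hl hL2.le
      have h4 : q * ((n + 1) * (h * Real.log 2)) - q * (2 * η) = q * (n + 1) * r * Real.log 2 := by
        rw [hηdef]; ring
      linarith
    have h2 : (2 : ℝ) ^ l ≤ Φ.card := by
      rw [← Real.log_le_log_iff (by positivity) (by exact_mod_cast hpos), Real.log_pow]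
      exact h1
    exact_mod_cast h2
  obtain ⟨c⟩ : Nonempty ((Fin l → Fin 2) ↪ Φ) :=
    Function.Embedding.nonempty_of_card_le (by simpa using hle)
  refine ((hasForm_W (n + 1)).tensorPow _).slocc_of_free ((hasForm_GHZ (n + 1)).tensorPow l)
    (fun y => (c y : Fin (q * (n + 1)) → Fin (n + 1))) (Subtype.val_injective.comp c.injective)
    (fun i y y' hyy => ?_) fun a ha => ?_
  · exact c.injective (Subtype.ext (hsep _ (c y).2 _ (c y').2
      ⟨i, fiber_eq_of_indicator_eq hyy⟩))
  · have hmem : a ∈ Φ := hfree a fun i => (ha i).elim fun y hy =>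
      ⟨c y, (c y).2, fiber_eq_of_indicator_eq hy⟩
    obtain ⟨y, hy⟩ := ha 0
    exact ⟨y, hsep a hmem _ (c y).2 ⟨0, fiber_eq_of_indicator_eq hy⟩⟩

/-- The number of binary words of length `m` and relative weight at most `1 / (n + 1)`. -/
theorem card_low_weight_le (n m : ℕ) (hn : 1 ≤ n) :
    ((Finset.univ.filter fun x : Fin m → Fin 2 =>
      (n + 1) * (Finset.univ.filter fun j => x j = 1).card ≤ m).card : ℝ) ≤
      (2 : ℝ) ^ (m * binaryEntropy (1 / ((n + 1 : ℕ) : ℝ))) := by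
  have hn0 : (1 : ℝ) ≤ n := by exact_mod_cast hn
  have hL2 : 0 < Real.log 2 := Real.log_pos (by norm_num)
  set Z := Finset.univ.filter fun x : Fin m → Fin 2 =>
      (n + 1) * (Finset.univ.filter fun j => x j = 1).card ≤ m with hZ
  -- Weights proportional to Bernoulli(1/(n+1)): letter 1 has weight 1, letter 0 has weight n, and
  -- each low-weight word has weight at least n^{nm/(n+1)}.
  have htotal : ∑ x : Fin m → Fin 2, ∏ j, (if x j = 1 then (1 : ℝ) else n) = (n + 1) ^ m := by
    have := Finset.prod_univ_sum (fun _ : Fin m => (Finset.univ : Finset (Fin 2)))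
      (fun _ b => if b = 1 then (1 : ℝ) else n)
    rw [Fintype.piFinset_univ] at this
    rw [← this]
    simp
  have hterm : ∀ x ∈ Z, (n : ℝ) ^ ((n : ℝ) * m / (n + 1)) ≤
      ∏ j, (if x j = 1 then (1 : ℝ) else n) := by
    intro x hx
    have hx := (Finset.mem_filter.1 hx).2
    have hcard := Finset.card_filter_add_card_filter_not (s := (Finset.univ : Finset (Fin m)))
      (fun j => x j = 1)
    rw [Finset.card_univ, Fintype.card_fin] at hcard
    rw [Finset.prod_ite, Finset.prod_const_one, one_mul, Finset.prod_const, ← Real.rpow_natCast]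
    refine Real.rpow_le_rpow_of_exponent_le hn0 ?_
    rw [div_le_iff₀ (by positivity)]
    have h1 : ((n : ℝ) + 1) * (Finset.univ.filter fun j => x j = 1).card ≤ m := by
      exact_mod_cast hx
    have h2 : ((Finset.univ.filter fun j => x j = 1).card : ℝ) +
        (Finset.univ.filter fun j => ¬ x j = 1).card = m := by exact_mod_cast hcard
    nlinarith
  have hmain : (Z.card : ℝ) * (n : ℝ) ^ ((n : ℝ) * m / (n + 1)) ≤ (n + 1) ^ m := by
    rw [← htotal, ← nsmul_eq_mul, ← Finset.sum_const]
    refine (Finset.sum_le_sum hterm).trans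
      (Finset.sum_le_sum_of_subset_of_nonneg (Finset.subset_univ _) fun x _ _ =>
        Finset.prod_nonneg fun j _ => ?_)
    split_ifs <;> positivity
  rw [← le_div_iff₀ (by positivity)] at hmain
  refine hmain.trans (le_of_eq ?_)
  have hent := mul_binaryEntropy_inv n hn
  rw [Real.rpow_def_of_pos (by positivity), Real.rpow_def_of_pos (by norm_num),
    show ((n : ℝ) + 1) ^ m = Real.exp (m * Real.log (n + 1)) by
      rw [Real.exp_nat_mul, Real.exp_log (by positivity)], ← Real.exp_sub]
  congr 1
  have hn1 : (n : ℝ) + 1 ≠ 0 := by positivity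
  refine mul_left_cancel₀ hn1 ?_
  calc _ = m * (((n : ℝ) + 1) * Real.log (n + 1) - n * Real.log n) := by field_simp
    _ = _ := by rw [← hent]; ring

theorem two_pow_le_of_slocc {p m l : ℕ}
    (h : ((W (p + 2)).tensorPow m).SLOCC ((GHZ (p + 2)).tensorPow l)) :
    (2 : ℝ) ^ l ≤ ((p + 2 : ℕ) : ℝ) *
      (2 : ℝ) ^ (m * binaryEntropy (1 / ((p + 2 : ℕ) : ℝ))) := by
  have h1 := ((hasForm_W (p + 2)).tensorPow m).card_le_of_slocc
    ((hasForm_GHZ (p + 2)).tensorPow l)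
    (fun _ => Finset.univ.filter fun x : Fin m → Fin 2 =>
      (p + 1 + 1) * (Finset.univ.filter fun j => x j = 1).card ≤ m) (fun f => by
      -- The k fiber sizes add up to m, so they cannot all exceed m/k.
      by_contra! hcon
      simp only [Finset.mem_filter, Finset.mem_univ, true_and, not_le] at hcon
      have h2 := Finset.sum_lt_sum_of_nonempty (s := (Finset.univ : Finset (Fin (p + 2))))
        Finset.univ_nonempty fun i _ => hcon i
      have h3 := Finset.card_eq_sum_card_fiberwise (f := f) (s := Finset.univ)
        (t := Finset.univ) fun _ _ => Finset.mem_coe.2 (Finset.mem_univ _)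
      rw [← Finset.mul_sum] at h2
      simp [eq_comm] at h2 h3
      rw [← h3] at h2
      omega) h
  rw [Finset.sum_const, Finset.card_univ, Fintype.card_fin, smul_eq_mul, Fintype.card_fun,
    Fintype.card_fin, Fintype.card_fin] at h1
  calc (2 : ℝ) ^ l ≤ ((p + 2 : ℕ) : ℝ) * _ := by exact_mod_cast h1
    _ ≤ _ := mul_le_mul_of_nonneg_left (card_low_weight_le (p + 1) m (by omega))
        (Nat.cast_nonneg _)

theorem ofReal_le_rate (p l : ℕ) (hl : 0 < l) :
    ENNReal.ofReal ((l - Real.logb 2 (p + 2 : ℕ)) /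
      (l * binaryEntropy (1 / ((p + 2 : ℕ) : ℝ)))) ≤ rate l (W (p + 2)) (GHZ (p + 2)) := by
  have hh := binaryEntropy_inv_pos (p + 1) (by omega)
  set h := binaryEntropy (1 / ((p + 1 + 1 : ℕ) : ℝ))
  have hl0 : (0 : ℝ) < l := by exact_mod_cast hl
  rw [rate, ENNReal.le_div_iff_mul_le (Or.inl (by positivity)) (Or.inl (ENNReal.natCast_ne_top l))]
  refine le_iInf₂ fun m hm => ?_
  rw [← ENNReal.ofReal_natCast l, ← ENNReal.ofReal_natCast m,
    ← ENNReal.ofReal_mul' (Nat.cast_nonneg _)]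
  refine ENNReal.ofReal_le_ofReal ?_
  have h1 := two_pow_le_of_slocc hm
  have h2 := Real.logb_le_logb_of_le (b := 2) (by norm_num) (by positivity) h1
  rw [Real.logb_mul (by positivity) (by positivity), Real.logb_rpow (by norm_num) (by norm_num),
    ← Real.rpow_natCast, Real.logb_rpow (by norm_num) (by norm_num)] at h2
  change (l - Real.logb 2 (p + 2 : ℕ)) / (l * h) * l ≤ m
  change (l : ℝ) ≤ _ + m * h at h2
  rw [mul_comm (l : ℝ) h, ← div_div, div_mul_cancel₀ _ hl0.ne', div_le_iff₀ hh]
  linarith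

end PartiteState

/-! ### The limit -/

theorem mainTheorem1 (k : ℕ) (hk : 2 ≤ k) :
    PartiteState.HasAsymptoticRate (PartiteState.W k) (PartiteState.GHZ k)
      (ENNReal.ofReal (1 / binaryEntropy (1 / (k : ℝ)))) := by
  obtain ⟨p, rfl⟩ := Nat.exists_eq_add_of_le' hk
  have hh : 0 < binaryEntropy (1 / ((p + 2 : ℕ) : ℝ)) := binaryEntropy_inv_pos (p + 1) (by omega)
  refine tendsto_order.2 ⟨fun a ha => ?_, fun b hb => ?_⟩
  · have hlim : Filter.Tendsto (fun l : ℕ => ENNReal.ofReal ((l - Real.logb 2 (p + 2 : ℕ)) /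
        (l * binaryEntropy (1 / ((p + 2 : ℕ) : ℝ))))) Filter.atTop
        (𝓝 (ENNReal.ofReal (1 / binaryEntropy (1 / ((p + 2 : ℕ) : ℝ))))) := by
      refine ENNReal.tendsto_ofReal ?_
      have h1 : Filter.Tendsto (fun l : ℕ => (1 - Real.logb 2 (p + 2 : ℕ) / (l : ℝ)) /
          binaryEntropy (1 / ((p + 2 : ℕ) : ℝ))) Filter.atTop
          (𝓝 ((1 - 0) / binaryEntropy (1 / ((p + 2 : ℕ) : ℝ)))) :=
        (tendsto_const_nhds.sub (tendsto_const_div_atTop_nhds_zero_nat _)).div_const _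
      rw [sub_zero] at h1
      refine h1.congr' ?_
      filter_upwards [Filter.eventually_gt_atTop 0] with l hl
      have hl0 : (l : ℝ) ≠ 0 := by positivity
      field_simp
    filter_upwards [hlim.eventually_const_lt ha, Filter.eventually_gt_atTop 0] with l hl hl0
    exact hl.trans_le (PartiteState.ofReal_le_rate p l hl0)
  · obtain ⟨r, hr0, hr1, hr2⟩ := ENNReal.lt_iff_exists_real_btwn.1 hb
    set h := binaryEntropy (1 / ((p + 2 : ℕ) : ℝ)) with hhdef
    have hr1' : 1 / h < r := (ENNReal.ofReal_lt_ofReal_iff_of_nonneg (by positivity)).1 hr1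
    have hrpos : 0 < r := lt_trans (by positivity) hr1'
    have hrh : 1 / r < h := (one_div_lt hh hrpos).1 hr1'
    -- A GHZ yield s per copy strictly below h costs 1/s < r copies each; the slack r − 1/s pays for
    -- rounding the copies up to a multiple of K = k.
    obtain ⟨s, hs1, hs2⟩ := exists_between hrh
    have hs0 : 0 < s := lt_trans (by positivity) hs1
    have hsr : 1 / s < r := (one_div_lt hrpos hs0).1 hs1
    obtain ⟨Q, hQ⟩ := PartiteState.slocc_W_GHZ (p + 1) (by omega) (r := s) hs2
    set K : ℝ := ((p + 1 : ℕ) : ℝ) + 1 with hK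
    have hKpos : 0 < K := by positivity
    have hlarge : ∀ᶠ l : ℕ in Filter.atTop, max (Q * (K * s)) (K / (r - 1 / s)) ≤ (l : ℝ) :=
      tendsto_natCast_atTop_atTop.eventually_ge_atTop _
    filter_upwards [hlarge, Filter.eventually_gt_atTop 0] with l hl hl0
    have hl0' : (0 : ℝ) < l := by exact_mod_cast hl0
    set q := ⌈(l : ℝ) / (K * s)⌉₊ with hq
    have hq1 : (l : ℝ) / (K * s) ≤ q := Nat.le_ceil _
    have hq2 : (q : ℝ) < l / (K * s) + 1 := Nat.ceil_lt_add_one (by positivity)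
    have hqQ : Q ≤ q := by
      have : (Q : ℝ) ≤ q := by
        refine le_trans ?_ hq1
        rw [le_div_iff₀ (by positivity)]
        exact (le_max_left _ _).trans hl
      exact_mod_cast this
    have hslocc := hQ q hqQ l (by
      rw [div_le_iff₀ (by positivity)] at hq1
      rw [mul_assoc]
      exact hq1)
    refine lt_of_le_of_lt ?_ hr2
    rw [PartiteState.rate]
    refine ENNReal.div_le_of_le_mul ?_
    refine (iInf₂_le (q * (p + 1 + 1)) hslocc).trans ?_
    rw [← ENNReal.ofReal_natCast, ← ENNReal.ofReal_natCast l, ← ENNReal.ofReal_mul hr0]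
    refine ENNReal.ofReal_le_ofReal ?_
    have hKl : K ≤ (r - 1 / s) * l := by
      have := (le_max_right _ _).trans hl
      rwa [div_le_iff₀' (sub_pos.2 hsr)] at this
    calc ((q * (p + 1 + 1) : ℕ) : ℝ) = q * K := by rw [hK]; push_cast; ring
      _ ≤ (l / (K * s) + 1) * K := mul_le_mul_of_nonneg_right hq2.le hKpos.le
      _ = 1 / s * l + K := by field_simp
      _ ≤ r * l := by linarith
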